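/- A factorization $f = pc$, with $c\colon X\to W$ and $p\colon W\to Y$, of a morphism in a category is called minimal if every morphism $\varphi\colon W\to W$ with $\varphi c=c$ and $p\varphi=p$ is an isomorphism. A model category $\mathcal{M}$ (a category with finite limits and colimits and with classes of weak equivalences, fibrations and cofibrations satisfying the usual two-out-of-three, retract, lifting and factorization axioms; factorizations are not required to be functorial) satisfies the minimal cofibrant factorization axiom if every morphism $f$ of $\mathcal{M}$ has a minimal factorization $f=pc$ in which $c$ is a cofibration and $p$ is both a fibration and a weak equivalence. Let $\mathcal{D}$ be a finite poset and $\mathcal{C}$ a model category. For $x\in\mathcal{D}$ let $\mathcal{D}<x$ denote the subposet of elements strictly smaller than $x$. Then the following choices of weak equivalences, fibrations and cofibrations in the functor category $\mathrm{Fun}(\mathcal{D},\mathcal{C})$ form a model structure. A morphism $\varphi\colon X\to Y$ is - a weak equivalence (respectively, a fibration) if, for every $x\in\mathcal{D}$, the morphism $\varphi(x)\colon X(x)\to Y(x)$ is a weak equivalence (respectively, a fibration) in $\mathcal{C}$; - a cofibration if, for every $x\in\mathcal{D}$, the mediating morphism $$\widehat{\varphi}(x)\colon \operatorname{colim}\Bigl(\operatorname{colim}_{\mathcal{D}<x}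 Y \xleftarrow{\ \operatorname{colim}_{\mathcal{D}<x}\varphi\ } \operatorname{colim}_{\mathcal{D}<x} X \to X(x)\Bigr)\to Y(x)$$ induced by $\operatorname{colim}_{\mathcal{D}<x}Y\to Y(x)$ and $\varphi(x)$ is a cofibration in $\mathcal{C}$. Furthermore, if $\mathcal{C}$ satisfies the minimal cofibrant factorization axiom, then so does $\mathrm{Fun}(\mathcal{D},\mathcal{C})$ with this model structure. -/

import Mathlib

open CategoryTheory CategoryTheory.Limits HomotopicalAlgebra

universe w v u

namespace FinitePosetModel

section Minimality

variable {C : Type u} [Category.{v} C]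

/-- A factorization of `c ≫ p` through `W` is minimal if every endomorphism of `W` which is
compatible with both `c` and `p` is an isomorphism. -/
def IsMinimalFactorization {X W Y : C} (c : X ⟶ W) (p : W ⟶ Y) : Prop :=
  ∀ φ : W ⟶ W, c ≫ φ = c → φ ≫ p = p → IsIso φ

/-- The minimal cofibrant factorization axiom: every morphism `f` of the model category `C`
factors as a cofibration `c` followed by a fibration `p` which is also a weak equivalence,
in such a way that this factorization is minimal. -/
def MinimalCofibrantFactorizationAxiom (C : Type u) [Category.{v} C] [ModelCategory C] : Prop :=
  ∀ ⦃X Y : C⦄ (f : X ⟶ Y), ∃ (W : C) (c : X ⟶ W) (p : W ⟶ Y),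
    c ≫ p = f ∧ Cofibration c ∧ Fibration p ∧ WeakEquivalence p ∧ IsMinimalFactorization c p

end Minimality

section Latching

variable {D : Type w} [PartialOrder D]

/-- The inclusion of the subposet `D < x` of elements strictly below `x`. -/
abbrev strictlyBelow (x : D) : Set.Iio x ⥤ D :=
  (Subtype.mono_coe (· ∈ Set.Iio x)).functor

variable {C : Type u} [Category.{v} C] [HasFiniteColimits C] [Finite D]

instance hasColimitsOfShape_strictlyBelow (x : D) : HasColimitsOfShape (Set.Iio x) C := by
  have : Fintype (Set.Iio x) := Fintype.ofFinite _
  infer_instance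

/-- The latching object `colim_{D < x} X`. -/
noncomputable def latchingObj (X : D ⥤ C) (x : D) : C :=
  colimit (strictlyBelow x ⋙ X)

/-- The structure morphism `X(y) ⟶ colim_{D < x} X` of the colimit, for `y < x`. -/
noncomputable def latchingι (X : D ⥤ C) {x y : D} (h : y < x) : X.obj y ⟶ latchingObj X x :=
  colimit.ι (strictlyBelow x ⋙ X) ⟨y, h⟩

lemma latchingObj_hom_ext {X : D ⥤ C} {x : D} {Z : C} {f g : latchingObj X x ⟶ Z}
    (h : ∀ (y : D) (hy : y < x), latchingι X hy ≫ f = latchingι X hy ≫ g) : f = g :=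
  colimit.hom_ext (F := strictlyBelow x ⋙ X) (fun y => h y.1 y.2)

/-- The cocone under the restriction of `X` to `D < x` with point `X(x)`, given at `y < x` by
the structure morphism `X(y) ⟶ X(x)`. -/
def latchingCocone (X : D ⥤ C) (x : D) : Cocone (strictlyBelow x ⋙ X) where
  pt := X.obj x
  ι :=
    { app := fun y => X.map (show (strictlyBelow x).obj y ⟶ x from
        homOfLE (le_of_lt (Set.mem_Iio.mp y.2)))
      naturality := fun y z g => by
        refine (X.map_comp _ _).symm.trans (Eq.trans ?_ (Category.comp_id _).symm)
        exact congrArg X.map (Subsingleton.elim _ _) }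

/-- The canonical morphism `colim_{D < x} X ⟶ X(x)`. -/
noncomputable def latchingMap (X : D ⥤ C) (x : D) : latchingObj X x ⟶ X.obj x :=
  colimit.desc (strictlyBelow x ⋙ X) (latchingCocone X x)

lemma latchingι_latchingMap (X : D ⥤ C) {x y : D} (h : y < x) :
    latchingι X h ≫ latchingMap X x = X.map (homOfLE h.le) :=
  colimit.ι_desc (latchingCocone X x) _

/-- The morphism `colim_{D < x} φ : colim_{D < x} X ⟶ colim_{D < x} Y`. -/
noncomputable def latchingObjMap {X Y : D ⥤ C} (φ : X ⟶ Y) (x : D) :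
    latchingObj X x ⟶ latchingObj Y x :=
  colimMap (Functor.whiskerLeft (strictlyBelow x) φ)

lemma latchingι_latchingObjMap {X Y : D ⥤ C} (φ : X ⟶ Y) {x y : D} (h : y < x) :
    latchingι X h ≫ latchingObjMap φ x = φ.app y ≫ latchingι Y h :=
  ι_colimMap (Functor.whiskerLeft (strictlyBelow x) φ) _

lemma latchingObjMap_comp_latchingMap {X Y : D ⥤ C} (φ : X ⟶ Y) (x : D) :
    latchingObjMap φ x ≫ latchingMap Y x = latchingMap X x ≫ φ.app x := by
  refine latchingObj_hom_ext (fun y hy => ?_)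
  rw [← Category.assoc, latchingι_latchingObjMap, Category.assoc, latchingι_latchingMap,
    ← Category.assoc, latchingι_latchingMap, φ.naturality]

/-- The mediating morphism from the pushout of
`colim_{D < x} Y ⟵ colim_{D < x} X ⟶ X(x)` to `Y(x)`. -/
noncomputable def relativeLatchingMap {X Y : D ⥤ C} (φ : X ⟶ Y) (x : D) :
    pushout (latchingObjMap φ x) (latchingMap X x) ⟶ Y.obj x :=
  pushout.desc (latchingMap Y x) (φ.app x) (latchingObjMap_comp_latchingMap φ x)

end Latching

section ProjectiveClasses

variable (D : Type w) [PartialOrder D] [Finite D] (C : Type u) [Category.{v} C] [ModelCategory C]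

/-- The natural transformations that are objectwise weak equivalences. -/
def objectwiseWeakEquivalences : MorphismProperty (D ⥤ C) :=
  fun _ _ φ => ∀ x : D, WeakEquivalence (φ.app x)

/-- The natural transformations that are objectwise fibrations. -/
def objectwiseFibrations : MorphismProperty (D ⥤ C) :=
  fun _ _ φ => ∀ x : D, Fibration (φ.app x)

/-- The natural transformations all of whose mediating morphisms are cofibrations. -/
def latchingCofibrations : MorphismProperty (D ⥤ C) :=
  fun _ _ φ => ∀ x : D, Cofibration (relativeLatchingMap φ x)

end ProjectiveClasses

end FinitePosetModel

/-!
Let `c : X ⟶ W` be a morphism of functors on a finite poset. A factorization `u ≫ v` of its relative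
latching map at `m` is the same thing as a factorization of `c` through a functor that differs from
`W` only at `m`; this functor is `replaceAt`. A morphism `i` lifts against its projection to `W` as
soon as the relative latching map of `i` at `m` lifts against `v`.

Modifying one value after the other along a chain of lower sets, starting from `Y`, one can factor
`X ⟶ Y` so that relative latching maps and values form prescribed factorizations in `C`, and one
can reach `X` itself from `Y`, so `i` lifts against `p : X ⟶ Y` when the relative latching maps
of `i` lift against the values of `p`. Conversely, let `i : A ⟶ B` lift against all objectwise
members of a class `R` stable under base change. Given a square from a relative latching map of `i`
to a member of `R`, pull that member back to `B(m)` and lift `𝟙 B` against the corresponding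
modification of `B`. Thus each weak factorization system of `C` induces one on functors.

For minimality, an endomorphism `φ` of a factorization `c ≫ p` that is invertible below `x` induces
an automorphism of the source of the relative latching map of `c` at `x`, and minimality of the
factorization formed by this map and `p(x)` makes `φ(x)` invertible.
-/

namespace FinitePosetModel

theorem lowerSet_induction {ι : Type*} [PartialOrder ι] [Finite ι] {P : Set ι → Prop}
    (empty : P ∅)
    (insert : ∀ (S : Set ι) (m : ι), IsLowerSet S → m ∉ S → (∀ y < m, y ∈ S) → P S →
      P (insert m S)) : P Set.univ := by
  obtain ⟨S, ⟨hS, hPS⟩, hmax⟩ := (wellFounded_gt (α := Set ι)).has_min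
    {S | IsLowerSet S ∧ P S} ⟨∅, isLowerSet_empty, empty⟩
  by_contra hP
  have hu : S ≠ Set.univ := fun h => hP (h ▸ hPS)
  obtain ⟨m, hm, hmin⟩ := (wellFounded_lt (α := ι)).has_min Sᶜ (Set.nonempty_compl.mpr hu)
  have hlt : ∀ y < m, y ∈ S := fun y hy => by_contra fun h => hmin y h hy
  have hlower : IsLowerSet (Insert.insert m S) := by
    rintro x y hyx (rfl | hx)
    · exact hyx.eq_or_lt.imp id (hlt y)
    · exact Or.inr (hS hyx hx)
  exact hmax _ ⟨hlower, insert S m hS hm hlt hPS⟩ (Set.ssubset_insert hm)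

section LatchingFunctoriality

variable {D : Type w} [PartialOrder D] {C : Type u} [Category.{v} C] [HasFiniteColimits C]
  [Finite D]

lemma map_latchingι (X : D ⥤ C) {x y z : D} (f : z ⟶ y) (hy : y < x) :
    X.map f ≫ latchingι X hy = latchingι X (f.le.trans_lt hy) :=
  colimit.w (strictlyBelow x ⋙ X)
    (homOfLE (show (⟨z, f.le.trans_lt hy⟩ : Set.Iio x) ≤ ⟨y, hy⟩ from f.le))

lemma latchingObjMap_id (X : D ⥤ C) (x : D) : latchingObjMap (𝟙 X) x = 𝟙 _ :=
  latchingObj_hom_ext fun y hy => by simp [latchingι_latchingObjMap]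

lemma latchingObjMap_comp {X Y Z : D ⥤ C} (f : X ⟶ Y) (g : Y ⟶ Z) (x : D) :
    latchingObjMap (f ≫ g) x = latchingObjMap f x ≫ latchingObjMap g x :=
  latchingObj_hom_ext fun y hy => by
    simp [latchingι_latchingObjMap, reassoc_of% @latchingι_latchingObjMap]

lemma isIso_latchingObjMap {X Y : D ⥤ C} (f : X ⟶ Y) (x : D)
    (hf : ∀ y < x, IsIso (f.app y)) : IsIso (latchingObjMap f x) := by
  have : IsIso (Functor.whiskerLeft (strictlyBelow x) f) := by
    rw [NatTrans.isIso_iff_isIso_app]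
    exact fun y => hf y.1 y.2
  exact inferInstanceAs (IsIso (colim.map (Functor.whiskerLeft (strictlyBelow x) f)))

/-- The source `X(x) ⊔_{colim_{D < x} X} colim_{D < x} Y` of the relative latching map of
`φ : X ⟶ Y` at `x`. -/
noncomputable abbrev relativeLatchingObj {X Y : D ⥤ C} (φ : X ⟶ Y) (x : D) : C :=
  pushout (latchingObjMap φ x) (latchingMap X x)

@[simp]
lemma inl_relativeLatchingMap {X Y : D ⥤ C} (φ : X ⟶ Y) (x : D) :
    pushout.inl _ _ ≫ relativeLatchingMap φ x = latchingMap Y x :=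
  pushout.inl_desc _ _ _

@[simp]
lemma inr_relativeLatchingMap {X Y : D ⥤ C} (φ : X ⟶ Y) (x : D) :
    pushout.inr _ _ ≫ relativeLatchingMap φ x = φ.app x :=
  pushout.inr_desc _ _ _

lemma inl_comp_of_fac {X W : D ⥤ C} {c : X ⟶ W} {x : D} {V : C} {u : relativeLatchingObj c x ⟶ V}
    {v : V ⟶ W.obj x} (huv : u ≫ v = relativeLatchingMap c x) :
    (pushout.inl _ _ ≫ u) ≫ v = latchingMap W x := by
  rw [Category.assoc, huv, inl_relativeLatchingMap]

/-- The functoriality of the source of the relative latching map under the fixed functor `X`. -/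
noncomputable def relativeLatchingObjMap {X Y Y' : D ⥤ C} {φ : X ⟶ Y} {φ' : X ⟶ Y'}
    (b : Y ⟶ Y') (h : φ ≫ b = φ') (x : D) :
    relativeLatchingObj φ x ⟶ relativeLatchingObj φ' x :=
  pushout.map _ _ _ _ (latchingObjMap b x) (𝟙 _) (𝟙 _)
    (by rw [Category.id_comp, ← latchingObjMap_comp, h]) (by simp)

@[simp]
lemma inl_relativeLatchingObjMap {X Y Y' : D ⥤ C} {φ : X ⟶ Y} {φ' : X ⟶ Y'}
    (b : Y ⟶ Y') (h : φ ≫ b = φ') (x : D) :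
    pushout.inl _ _ ≫ relativeLatchingObjMap b h x = latchingObjMap b x ≫ pushout.inl _ _ :=
  pushout.inl_desc _ _ _

@[simp]
lemma inr_relativeLatchingObjMap {X Y Y' : D ⥤ C} {φ : X ⟶ Y} {φ' : X ⟶ Y'}
    (b : Y ⟶ Y') (h : φ ≫ b = φ') (x : D) :
    pushout.inr _ _ ≫ relativeLatchingObjMap b h x = pushout.inr _ _ :=
  (pushout.inr_desc _ _ _).trans (Category.id_comp _)

lemma relativeLatchingObjMap_comp_relativeLatchingMap {X Y Y' : D ⥤ C} {φ : X ⟶ Y}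
    {φ' : X ⟶ Y'} (b : Y ⟶ Y') (h : φ ≫ b = φ') (x : D) :
    relativeLatchingObjMap b h x ≫ relativeLatchingMap φ' x =
      relativeLatchingMap φ x ≫ b.app x := by
  apply pushout.hom_ext
  · simp [latchingObjMap_comp_latchingMap, reassoc_of% @inl_relativeLatchingObjMap,
      reassoc_of% @inl_relativeLatchingMap]
  · simp [reassoc_of% @inr_relativeLatchingObjMap, reassoc_of% @inr_relativeLatchingMap, ← h]

lemma isIso_relativeLatchingObjMap {X Y Y' : D ⥤ C} {φ : X ⟶ Y} {φ' : X ⟶ Y'}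
    (b : Y ⟶ Y') (h : φ ≫ b = φ') (x : D) (hb : ∀ y < x, IsIso (b.app y)) :
    IsIso (relativeLatchingObjMap b h x) := by
  have := isIso_latchingObjMap b x hb
  exact pushout.map_isIso _ _ _ _ (latchingObjMap b x) (𝟙 _) (𝟙 _)
    (by rw [Category.id_comp, ← latchingObjMap_comp, h]) (by simp)

end LatchingFunctoriality

section Replacement

variable {D : Type w} [PartialOrder D] [Finite D] {C : Type u} [Category.{v} C]
  [HasFiniteColimits C] [HasFiniteLimits C]
  {W : D ⥤ C} {m : D} {V : C} (a : latchingObj W m ⟶ V) (v : V ⟶ W.obj m)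

variable (W m V) in
/-- The target of the two morphisms whose pullback is `replaceObj`. Products indexed by
propositions avoid a case distinction on the position of `z` relative to `m`. -/
noncomputable abbrev replaceBase (z : D) : C :=
  (∏ᶜ fun _ : PLift (z ≤ m) => W.obj m) ⨯ ∏ᶜ fun _ : PLift (z < m) => V

/-- The morphism with components `W(z) ⟶ W(m)` if `z ≤ m`, and `W(z) ⟶ V` if `z < m`. -/
noncomputable abbrev oldToBase (z : D) : W.obj z ⟶ replaceBase W m V z :=
  prod.lift (Pi.lift fun h => W.map (homOfLE h.down)) (Pi.lift fun h => latchingι W h.down ≫ a)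

/-- The morphism with components `v` if `z ≤ m`, and the identity of `V` if `z < m`. -/
noncomputable abbrev newToBase (z : D) :
    (∏ᶜ fun _ : PLift (z ≤ m) => V) ⟶ replaceBase W m V z :=
  prod.lift (Pi.lift fun h => Pi.π _ h ≫ v) (Pi.lift fun h => Pi.π _ ⟨h.down.le⟩)

/-- The value at `z` of the functor obtained from `W` by putting `V` in place of `W(m)`, along
`a : colim_{D < m} W ⟶ V` and `v : V ⟶ W(m)`. In terms of elements, it consists of `w` in `W(z)`
together with, if `z ≤ m`, some `t` in `V` such that `v t` is the image of `w` and, if `z < m`,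
such that `t = a w`. -/
noncomputable def replaceObj (z : D) : C :=
  pullback (oldToBase a z) (newToBase v z)

namespace replaceObj

/-- The projection to the value of the original functor. -/
noncomputable def toOld (z : D) : replaceObj a v z ⟶ W.obj z :=
  pullback.fst _ _

/-- The projection to the new value, available at the elements below the modified one. -/
noncomputable def toNew {z : D} (h : z ≤ m) : replaceObj a v z ⟶ V :=
  pullback.snd _ _ ≫ Pi.π (fun _ : PLift (z ≤ m) => V) ⟨h⟩

@[simp]
lemma toNew_comp {z : D} (h : z ≤ m) : toNew a v h ≫ v = toOld a v z ≫ W.map (homOfLE h) := by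
  have w := pullback.condition (f := oldToBase a z) (g := newToBase v z) =≫
    (prod.fst ≫ Pi.π _ ⟨h⟩)
  simp only [Category.assoc, prod.lift_fst_assoc, Pi.lift_π] at w
  exact (Category.assoc _ _ _).trans w.symm

lemma toNew_of_lt {z : D} (h : z < m) :
    toNew a v h.le = toOld a v z ≫ latchingι W h ≫ a := by
  have w := pullback.condition (f := oldToBase a z) (g := newToBase v z) =≫
    (prod.snd ≫ Pi.π _ ⟨h⟩)
  simp only [Category.assoc, prod.lift_snd_assoc, Pi.lift_π] at w
  exact w.symm

variable {a v}

/-- The morphism to `replaceObj a v z` with prescribed components. -/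
noncomputable def lift {B : C} {z : D} (g : B ⟶ W.obj z) (k : z ≤ m → (B ⟶ V))
    (hv : ∀ h, k h ≫ v = g ≫ W.map (homOfLE h))
    (ha : ∀ h : z < m, k h.le = g ≫ latchingι W h ≫ a) : B ⟶ replaceObj a v z :=
  pullback.lift g (Pi.lift fun h => k h.down) (by
    simp only [prod.comp_lift]
    congr 1 <;> ext h
    · simp [hv]
    · simp [ha h.down])

@[simp]
lemma lift_toOld {B : C} {z : D} (g : B ⟶ W.obj z) (k : z ≤ m → (B ⟶ V))
    (hv : ∀ h, k h ≫ v = g ≫ W.map (homOfLE h))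
    (ha : ∀ h : z < m, k h.le = g ≫ latchingι W h ≫ a) : lift g k hv ha ≫ toOld a v z = g :=
  pullback.lift_fst _ _ _

@[simp]
lemma lift_toNew {B : C} {z : D} (g : B ⟶ W.obj z) (k : z ≤ m → (B ⟶ V))
    (hv : ∀ h, k h ≫ v = g ≫ W.map (homOfLE h))
    (ha : ∀ h : z < m, k h.le = g ≫ latchingι W h ≫ a) (h : z ≤ m) :
    lift g k hv ha ≫ toNew a v h = k h :=
  (pullback.lift_snd_assoc _ _ _ _).trans (Pi.lift_π _ _)

lemma hom_ext {B : C} {z : D} {f g : B ⟶ replaceObj a v z}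
    (hold : f ≫ toOld a v z = g ≫ toOld a v z)
    (hnew : ∀ h : z ≤ m, f ≫ toNew a v h = g ≫ toNew a v h) : f = g :=
  pullback.hom_ext hold <| Pi.hom_ext _ _ fun h =>
    (Category.assoc _ _ _).trans ((hnew h.down).trans (Category.assoc _ _ _).symm)

end replaceObj

open replaceObj

/-- The functor obtained from `W` by putting `V` in place of `W(m)`, along
`a : colim_{D < m} W ⟶ V` and `v : V ⟶ W(m)`. -/
noncomputable abbrev replaceAt : D ⥤ C where
  obj := replaceObj a v
  map {y z} f := lift (toOld a v y ≫ W.map f) (fun h => toNew a v (f.le.trans h))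
    (fun h => by simp only [Category.assoc, ← W.map_comp, toNew_comp]; rfl)
    (fun h => by
      rw [toNew_of_lt a v (f.le.trans_lt h), Category.assoc, reassoc_of% map_latchingι W f])
  map_id z := hom_ext (by simp) (by simp)
  map_comp f g := hom_ext (by simp [reassoc_of% @lift_toOld]) (by simp)

namespace replaceAt

/-- The natural transformation to the original functor. -/
noncomputable abbrev π : replaceAt a v ⟶ W where
  app := toOld a v
  naturality _ _ _ := by rw [lift_toOld]

/-- The projection of the value at `m` to `V`. -/
noncomputable abbrev proj : (replaceAt a v).obj m ⟶ V :=
  toNew a v le_rfl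

lemma map_proj {z : D} (h : z ≤ m) :
    (replaceAt a v).map (homOfLE h) ≫ proj a v = toNew a v h := by
  rw [lift_toNew]

lemma proj_comp : proj a v ≫ v = (π a v).app m := by
  rw [toNew_comp, Subsingleton.elim (homOfLE _) (𝟙 m), W.map_id, Category.comp_id]

lemma latchingMap_proj :
    latchingMap (replaceAt a v) m ≫ proj a v = latchingObjMap (π a v) m ≫ a :=
  latchingObj_hom_ext fun y hy => by
    rw [reassoc_of% latchingι_latchingMap _ hy, reassoc_of% latchingι_latchingObjMap _ hy, map_proj,
      toNew_of_lt a v hy]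

variable {a v}

lemma isIso_π_app (hav : a ≫ v = latchingMap W m) {z : D} (hz : z ≠ m) :
    IsIso ((π a v).app z) := by
  have hlt (h : z ≤ m) : z < m := h.lt_of_ne hz
  let s : W.obj z ⟶ replaceObj a v z := lift (𝟙 _) (fun h => latchingι W (hlt h) ≫ a)
    (fun h => by rw [Category.assoc, hav, latchingι_latchingMap, Category.id_comp])
    (fun h => (Category.id_comp _).symm)
  refine ⟨s, hom_ext ?_ fun h => ?_, by simp [s]⟩
  · simp [s]
  · simp [s, toNew_of_lt a v (hlt h), reassoc_of% @lift_toOld]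

instance : IsIso (proj a v) := by
  let s : V ⟶ replaceObj a v m := lift v (fun _ => 𝟙 V)
    (fun h => by rw [Category.id_comp, Subsingleton.elim (homOfLE _) (𝟙 m), W.map_id,
      Category.comp_id])
    (fun h => (lt_irrefl m h).elim)
  refine ⟨s, hom_ext ?_ fun h => ?_, by simp [s]⟩
  · simp [s]
  · simp [s]

lemma functorCategory_π {R : MorphismProperty C} [R.ContainsIdentities] [R.RespectsIso]
    (hav : a ≫ v = latchingMap W m) (hv : R v) : R.functorCategory D (π a v) := fun z => by
  obtain rfl | hz := eq_or_ne z m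
  · rwa [← proj_comp, R.cancel_left_of_respectsIso]
  · have := isIso_π_app hav hz
    exact R.of_isIso _

/-- The morphism to `replaceAt a v` determined by its composition with `π a v` and by the
composition of its value at `m` with `proj a v`. -/
noncomputable abbrev lift {B : D ⥤ C} (g : B ⟶ W) (k : B.obj m ⟶ V) (hv : k ≫ v = g.app m)
    (ha : latchingMap B m ≫ k = latchingObjMap g m ≫ a) : B ⟶ replaceAt a v where
  app z := replaceObj.lift (g.app z) (fun h => B.map (homOfLE h) ≫ k) (fun h => by simp [hv])
    (fun h => by rw [← latchingι_latchingMap B h, Category.assoc, ha,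
      reassoc_of% latchingι_latchingObjMap g h])
  naturality y z f := hom_ext (by simp [reassoc_of% @lift_toOld])
    (fun h => by simp only [Category.assoc, lift_toNew, ← B.map_comp_assoc]; rfl)

variable {B : D ⥤ C} (g : B ⟶ W) (k : B.obj m ⟶ V) (hv : k ≫ v = g.app m)
  (ha : latchingMap B m ≫ k = latchingObjMap g m ≫ a)

@[simp]
lemma lift_π : lift g k hv ha ≫ π a v = g := by
  ext z
  rw [NatTrans.comp_app, lift_toOld]

lemma lift_app_proj : (lift g k hv ha).app m ≫ proj a v = k := by
  rw [lift_toNew, Subsingleton.elim (homOfLE _) (𝟙 m), B.map_id, Category.id_comp]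

lemma hom_ext {f f' : B ⟶ replaceAt a v} (hπ : f ≫ π a v = f' ≫ π a v)
    (hproj : f.app m ≫ proj a v = f'.app m ≫ proj a v) : f = f' := by
  ext z
  refine replaceObj.hom_ext (NatTrans.congr_app hπ z) fun h => ?_
  rw [← map_proj, ← reassoc_of% f.naturality, hproj, reassoc_of% f'.naturality]

theorem hasLiftingProperty_π (hav : a ≫ v = latchingMap W m) {A : D ⥤ C} (i : A ⟶ B)
    [HasLiftingProperty (relativeLatchingMap i m) v] : HasLiftingProperty i (π a v) where
  sq_hasLift {f g} sq := by
    have hw : latchingObjMap i m ≫ latchingObjMap g m ≫ a =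
        latchingMap A m ≫ f.app m ≫ proj a v := by
      rw [← reassoc_of% @latchingObjMap_comp, ← sq.w, latchingObjMap_comp, Category.assoc,
        ← latchingMap_proj, reassoc_of% latchingObjMap_comp_latchingMap f m]
    have sqm : CommSq (pushout.desc _ _ hw) (relativeLatchingMap i m) v (g.app m) := ⟨by
      apply pushout.hom_ext
      · rw [pushout.inl_desc_assoc, Category.assoc, hav, latchingObjMap_comp_latchingMap,
          reassoc_of% @inl_relativeLatchingMap]
      · rw [pushout.inr_desc_assoc, Category.assoc, proj_comp, reassoc_of% @inr_relativeLatchingMap,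
          ← NatTrans.comp_app, sq.w, NatTrans.comp_app]⟩
    have hinl : latchingMap B m ≫ sqm.lift = latchingObjMap g m ≫ a := by
      rw [← inl_relativeLatchingMap i, Category.assoc, sqm.fac_left, pushout.inl_desc]
    have hinr : i.app m ≫ sqm.lift = f.app m ≫ proj a v := by
      rw [← inr_relativeLatchingMap, Category.assoc, sqm.fac_left, pushout.inr_desc]
    exact CommSq.HasLift.mk'
      { l := lift g sqm.lift sqm.fac_right hinl
        fac_left := hom_ext (by rw [Category.assoc, lift_π, sq.w])
          (by rw [NatTrans.comp_app, Category.assoc, lift_app_proj, hinr])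
        fac_right := lift_π _ _ _ _ }

section Factor

variable {X : D ⥤ C} {c : X ⟶ W} {u : relativeLatchingObj c m ⟶ V}

/-- A factorization `u ≫ v` of the relative latching map of `c : X ⟶ W` at `m` makes `c` factor
through the functor that has the intermediate object in place of `W(m)`. -/
noncomputable abbrev factor (huv : u ≫ v = relativeLatchingMap c m) :
    X ⟶ replaceAt (pushout.inl _ _ ≫ u) v :=
  lift c (pushout.inr _ _ ≫ u) (by rw [Category.assoc, huv, inr_relativeLatchingMap])
    (pushout.condition_assoc u).symm

lemma relativeLatchingMap_factor_proj (huv : u ≫ v = relativeLatchingMap c m) :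
    relativeLatchingMap (factor huv) m ≫ proj _ _ =
      relativeLatchingObjMap (π _ _) (lift_π _ _ _ _) m ≫ u := by
  apply pushout.hom_ext
  · rw [reassoc_of% @inl_relativeLatchingMap, latchingMap_proj,
      reassoc_of% @inl_relativeLatchingObjMap]
  · rw [reassoc_of% @inr_relativeLatchingMap, lift_app_proj,
      reassoc_of% @inr_relativeLatchingObjMap]

theorem exists_comp_eq_of_hasLiftingProperty_π (huv : u ≫ v = relativeLatchingMap c m)
    [HasLiftingProperty c (π (pushout.inl _ _ ≫ u) v)] :
    ∃ r : W.obj m ⟶ V, relativeLatchingMap c m ≫ r = u ∧ r ≫ v = 𝟙 _ := by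
  have sq : CommSq (factor huv) c (π _ _) (𝟙 W) := ⟨by rw [lift_π, Category.comp_id]⟩
  have hright : sq.lift ≫ π _ _ = 𝟙 W := sq.fac_right
  have hleft : c ≫ sq.lift = factor huv := sq.fac_left
  refine ⟨sq.lift.app m ≫ proj _ _, pushout.hom_ext ?_ ?_, ?_⟩
  · rw [reassoc_of% @inl_relativeLatchingMap, ← reassoc_of% @latchingObjMap_comp_latchingMap,
      latchingMap_proj, ← reassoc_of% @latchingObjMap_comp, hright, latchingObjMap_id,
      Category.id_comp]
  · rw [reassoc_of% @inr_relativeLatchingMap, ← reassoc_of% NatTrans.comp_app, hleft,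
      lift_app_proj]
  · rw [Category.assoc, proj_comp, ← NatTrans.comp_app, hright, NatTrans.id_app]

end Factor

end replaceAt

end Replacement

section LiftingProperty

variable {D : Type w} [PartialOrder D] [Finite D] {C : Type u} [Category.{v} C]
  [HasFiniteColimits C] [HasFiniteLimits C]

open replaceAt

theorem hasLiftingProperty_of_relativeLatchingMap {A B X Y : D ⥤ C} (i : A ⟶ B) (p : X ⟶ Y)
    [hlift : ∀ x, HasLiftingProperty (relativeLatchingMap i x) (p.app x)] :
    HasLiftingProperty i p := by
  suffices ∃ (W : D ⥤ C) (r : X ⟶ W) (q : W ⟶ Y), r ≫ q = p ∧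
      (∀ x ∈ Set.univ, IsIso (r.app x)) ∧ (∀ x ∉ Set.univ, IsIso (q.app x)) ∧
      HasLiftingProperty i q by
    obtain ⟨W, r, q, rfl, hr, -, hq⟩ := this
    have : IsIso r := (NatTrans.isIso_iff_isIso_app r).2 fun x => hr x trivial
    infer_instance
  refine lowerSet_induction (P := fun S => ∃ (W : D ⥤ C) (r : X ⟶ W) (q : W ⟶ Y), r ≫ q = p ∧
      (∀ x ∈ S, IsIso (r.app x)) ∧ (∀ x ∉ S, IsIso (q.app x)) ∧ HasLiftingProperty i q)
    ⟨Y, p, 𝟙 Y, Category.comp_id p, fun x hx => hx.elim, inferInstance, inferInstance⟩ ?_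
  rintro S m - hm hlt ⟨W, r, q, hp, hr, hq, hiq⟩
  have := isIso_latchingObjMap r m fun y hy => hr y (hlt y hy)
  have := hq m hm
  let u : relativeLatchingObj r m ⟶ X.obj m := inv (pushout.inr _ _)
  have hfac : u ≫ r.app m = relativeLatchingMap r m := by
    rw [IsIso.inv_comp_eq, inr_relativeLatchingMap]
  have : HasLiftingProperty (relativeLatchingMap i m) (r.app m) := by
    have e : Arrow.mk (p.app m) ≅ Arrow.mk (r.app m) :=
      Arrow.isoMk (Iso.refl _) (asIso (q.app m)).symm (by simp [← hp])
    exact HasLiftingProperty.of_arrow_iso_right _ e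
  have := hasLiftingProperty_π (inl_comp_of_fac hfac) i
  refine ⟨_, factor hfac, π _ _ ≫ q, ?_, ?_, ?_, inferInstance⟩
  · rw [reassoc_of% @lift_π, hp]
  · rintro x (rfl | hx)
    · exact IsIso.of_isIso_fac_right (lift_app_proj _ _ _ _)
    · have := isIso_π_app (inl_comp_of_fac hfac) (ne_of_mem_of_not_mem hx hm)
      have := hr x hx
      exact IsIso.of_isIso_fac_right (NatTrans.congr_app (lift_π _ _ _ _) x)
  · intro x hx
    have := isIso_π_app (inl_comp_of_fac hfac) fun h => hx (Or.inl h)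
    have := hq x fun h => hx (Or.inr h)
    rw [NatTrans.comp_app]
    infer_instance

end LiftingProperty

section ComposablePairs

variable {C : Type u} [Category.{v} C]

lemma prop_mk₂_iff_of_isIso (Q : ObjectProperty (ComposableArrows C 2))
    [Q.IsClosedUnderIsomorphisms] {A₁ A₂ B₁ B₂ Z₁ Z₂ : C} {c₁ : A₁ ⟶ B₁} {p₁ : B₁ ⟶ Z₁}
    {c₂ : A₂ ⟶ B₂} {p₂ : B₂ ⟶ Z₂} (e : A₁ ⟶ A₂) (g : B₁ ⟶ B₂) (k : Z₁ ⟶ Z₂)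
    [IsIso e] [IsIso g] [IsIso k] (hc : c₁ ≫ g = e ≫ c₂) (hp : p₁ ≫ k = g ≫ p₂) :
    Q (.mk₂ c₁ p₁) ↔ Q (.mk₂ c₂ p₂) :=
  Q.prop_iff_of_iso <| ComposableArrows.isoMk₂
    (asIso e : A₁ ≅ A₂) (asIso g : B₁ ≅ B₂) (asIso k : Z₁ ≅ Z₂) hc hp

/-- The pairs of composable morphisms whose first member is in `L` and whose second is in `R`. -/
def composablePairs (L R : MorphismProperty C) : ObjectProperty (ComposableArrows C 2) :=
  fun F => L (F.map' 0 1) ∧ R (F.map' 1 2)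

instance (L R : MorphismProperty C) [L.RespectsIso] [R.RespectsIso] :
    (composablePairs L R).IsClosedUnderIsomorphisms where
  of_iso e h := ⟨
    (L.arrow_mk_iso_iff (Arrow.isoMk (e.app 0) (e.app 1) (e.hom.naturality _).symm)).1 h.1,
    (R.arrow_mk_iso_iff (Arrow.isoMk (e.app 1) (e.app 2) (e.hom.naturality _).symm)).1 h.2⟩

end ComposablePairs

section Factorization

variable {D : Type w} [PartialOrder D] [Finite D] {C : Type u} [Category.{v} C]
  [HasFiniteColimits C] [HasFiniteLimits C]

open replaceAt

theorem exists_latching_factorization (Q : ObjectProperty (ComposableArrows C 2))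
    [Q.IsClosedUnderIsomorphisms]
    (hQ : ∀ ⦃A Z : C⦄ (f : A ⟶ Z), ∃ (B : C) (c : A ⟶ B) (p : B ⟶ Z), c ≫ p = f ∧ Q (.mk₂ c p))
    {X Y : D ⥤ C} (f : X ⟶ Y) :
    ∃ (W : D ⥤ C) (c : X ⟶ W) (p : W ⟶ Y), c ≫ p = f ∧
      ∀ x, Q (.mk₂ (relativeLatchingMap c x) (p.app x)) := by
  suffices ∃ (W : D ⥤ C) (c : X ⟶ W) (p : W ⟶ Y), c ≫ p = f ∧
      (∀ x ∈ Set.univ, Q (.mk₂ (relativeLatchingMap c x) (p.app x))) ∧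
      ∀ x ∉ Set.univ, IsIso (p.app x) by
    obtain ⟨W, c, p, h, hc, -⟩ := this
    exact ⟨W, c, p, h, fun x => hc x trivial⟩
  refine lowerSet_induction (P := fun S => ∃ (W : D ⥤ C) (c : X ⟶ W) (p : W ⟶ Y), c ≫ p = f ∧
      (∀ x ∈ S, Q (.mk₂ (relativeLatchingMap c x) (p.app x))) ∧ ∀ x ∉ S, IsIso (p.app x))
    ⟨Y, f, 𝟙 Y, Category.comp_id f, fun x hx => hx.elim, inferInstance⟩ ?_
  rintro S m hS hm - ⟨W, c, p, hcp, hSQ, hSiso⟩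
  obtain ⟨V, u, v, huv, hQuv⟩ := hQ (relativeLatchingMap c m)
  have hπ {z : D} (hz : z ≠ m) := isIso_π_app (inl_comp_of_fac huv) hz
  have hlatch (x : D) (hx : ∀ y < x, y ≠ m) :=
    isIso_relativeLatchingObjMap (π _ _) (lift_π _ _ _ _ : factor huv ≫ π _ _ = c) x
      fun y hy => hπ (hx y hy)
  refine ⟨_, factor huv, π _ _ ≫ p, by rw [reassoc_of% @lift_π, hcp], ?_, fun x hx => ?_⟩
  · rintro x (rfl | hx)
    · have := hlatch x fun y hy => hy.ne
      have := hSiso x hm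
      refine (prop_mk₂_iff_of_isIso Q _ (proj _ _) (inv (p.app x))
        (relativeLatchingMap_factor_proj huv) ?_).2 hQuv
      rw [proj_comp, NatTrans.comp_app, Category.assoc, IsIso.hom_inv_id, Category.comp_id]
    · have hne : ∀ y ≤ x, y ≠ m := fun y hy hym => hm (hym ▸ hS hy hx)
      have := hlatch x fun y hy => hne y hy.le
      have := hπ (hne x le_rfl)
      refine (prop_mk₂_iff_of_isIso Q _ ((π _ _).app x) (𝟙 _)
        (relativeLatchingObjMap_comp_relativeLatchingMap _ (lift_π _ _ _ _) _).symm ?_).2 (hSQ x hx)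
      rw [NatTrans.comp_app, Category.comp_id]
  · have := hπ fun h => hx (Or.inl h)
    have := hSiso x fun h => hx (Or.inr h)
    rw [NatTrans.comp_app]
    infer_instance

end Factorization

section WeakFactorizationSystem

variable {C : Type u} [Category.{v} C]

theorem llp_functorCategory_le (R : MorphismProperty C) (J : Type*) [Category* J]
    [∀ a b : J, HasProductsOfShape (a ⟶ b) C]
    [∀ a b : J, R.IsStableUnderProductsOfShape (a ⟶ b)] :
    (R.functorCategory J).llp ≤ R.llp.functorCategory J := by
  intro A B i hi x E F p hp
  have hp' : R.functorCategory J ((evaluationRightAdjoint C x).map p) := fun y => by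
    let f : (Discrete.functor fun _ : y ⟶ x => E) ⟶ Discrete.functor fun _ : y ⟶ x => F :=
      Discrete.natTrans fun _ => p
    exact R.limMap f fun _ => hp
  exact ((evaluationAdjunctionLeft C x).hasLiftingProperty_iff i p).2 (hi _ hp')

variable (D : Type w) [PartialOrder D] [HasFiniteColimits C] [Finite D]

/-- The natural transformations all of whose relative latching maps are in `L`. -/
def latchingProperty (L : MorphismProperty C) : MorphismProperty (D ⥤ C) :=
  fun _ _ φ => ∀ x : D, L (relativeLatchingMap φ x)

variable [HasFiniteLimits C]

theorem latchingProperty_llp (R : MorphismProperty C) [R.IsStableUnderBaseChange]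
    [R.ContainsIdentities] :
    latchingProperty D R.llp = (R.functorCategory D).llp := by
  refine le_antisymm (fun A B i hi X Y p hp => ?_) fun A B i hi m E F p hp => ⟨fun {t g} sq => ?_⟩
  · have (x : D) := hi x _ (hp x)
    exact hasLiftingProperty_of_relativeLatchingMap i p
  · have hfac : pullback.lift _ t sq.w.symm ≫ pullback.fst g p = relativeLatchingMap i m :=
      pullback.lift_fst _ _ _
    have := hi _ (replaceAt.functorCategory_π (inl_comp_of_fac hfac) (R.pullback_fst _ _ hp))
    obtain ⟨r, hr, hrfst⟩ := replaceAt.exists_comp_eq_of_hasLiftingProperty_π hfac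
    exact CommSq.HasLift.mk'
      { l := r ≫ pullback.snd g p
        fac_left := by rw [reassoc_of% hr, pullback.lift_snd]
        fac_right := by
          rw [Category.assoc, ← pullback.condition, reassoc_of% hrfst] }

theorem isWeakFactorizationSystem_latchingProperty (L R : MorphismProperty C)
    [L.IsWeakFactorizationSystem R] :
    (latchingProperty D L).IsWeakFactorizationSystem (R.functorCategory D) := by
  have hL := L.llp_eq_of_wfs R
  have hR := L.rlp_eq_of_wfs R
  have : L.IsStableUnderRetracts := hL ▸ inferInstance
  have : R.IsStableUnderRetracts := hR ▸ inferInstance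
  have : R.IsStableUnderBaseChange := hR ▸ inferInstance
  have : R.IsMultiplicative := hR ▸ inferInstance
  have hllp : (R.functorCategory D).llp = latchingProperty D L := by
    rw [← latchingProperty_llp, hL]
  have : (latchingProperty D L).IsStableUnderRetracts := hllp ▸ inferInstance
  have : (latchingProperty D L).HasFactorization (R.functorCategory D) := ⟨fun f => by
    obtain ⟨W, c, p, h, hcp⟩ := exists_latching_factorization (composablePairs L R)
      (fun A Z f => by
        have d := MorphismProperty.factorizationData L R f
        exact ⟨d.Z, d.i, d.p, d.fac, d.hi, d.hp⟩) f
    exact ⟨⟨W, c, p, h, fun x => (hcp x).1, fun x => (hcp x).2⟩⟩⟩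
  exact .mk' _ _ fun i p hi hp => by
    rw [← hllp] at hi
    exact hi p hp

end WeakFactorizationSystem

section Minimal

variable {C : Type u} [Category.{v} C]

variable (C) in
/-- The pairs of composable morphisms that form a minimal factorization of their composition. -/
def minimalFactorizations : ObjectProperty (ComposableArrows C 2) :=
  fun F => IsMinimalFactorization (F.map' 0 1) (F.map' 1 2)

instance : (minimalFactorizations C).IsClosedUnderIsomorphisms where
  of_iso {F G} e h φ hφc hφp := by
    have h₀₁ : F.map' 0 1 ≫ e.hom.app 1 = e.hom.app 0 ≫ G.map' 0 1 := e.hom.naturality _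
    have h₁₂ : F.map' 1 2 ≫ e.hom.app 2 = e.hom.app 1 ≫ G.map' 1 2 := e.hom.naturality _
    have : IsIso (e.hom.app 1 ≫ φ ≫ e.inv.app 1) := by
      refine h _ ?_ ?_
      · rw [reassoc_of% h₀₁, reassoc_of% hφc, ← reassoc_of% h₀₁, Iso.hom_inv_id_app]
        exact Category.comp_id _
      · rw [← cancel_mono (e.hom.app 2), Category.assoc, h₁₂, Category.assoc, Category.assoc,
          Iso.inv_hom_id_app_assoc, hφp]
    have : IsIso (φ ≫ e.inv.app 1) := IsIso.of_isIso_comp_left (e.hom.app 1) _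
    exact IsIso.of_isIso_comp_right φ (e.inv.app 1)

theorem IsMinimalFactorization.isIso_of_comm {A B Z : C} {c : A ⟶ B} {p : B ⟶ Z}
    (h : IsMinimalFactorization c p) [HasLiftingProperty c p] (φ : B ⟶ B) (a : A ⟶ A) [IsIso a]
    (hc : c ≫ φ = a ≫ c) (hp : φ ≫ p = p) : IsIso φ := by
  have sq : CommSq (inv a ≫ c) c p p :=
    ⟨by rw [Category.assoc, IsIso.inv_comp_eq, ← reassoc_of% hc, hp]⟩
  have hφs : IsIso (φ ≫ sq.lift) := h _
    (by rw [reassoc_of% hc, sq.fac_left, IsIso.hom_inv_id_assoc])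
    (by rw [Category.assoc, sq.fac_right, hp])
  have hsφ : IsIso (sq.lift ≫ φ) := h _
    (by rw [reassoc_of% sq.fac_left, hc, IsIso.inv_hom_id_assoc])
    (by rw [Category.assoc, hp, sq.fac_right])
  have : Mono φ := mono_of_mono φ sq.lift
  have : IsSplitEpi φ := IsSplitEpi.mk' ⟨inv (sq.lift ≫ φ) ≫ sq.lift, by simp⟩
  exact isIso_of_mono_of_isSplitEpi φ

variable {D : Type w} [PartialOrder D] [HasFiniteColimits C] [Finite D]

theorem isMinimalFactorization_of_relativeLatchingMap {X W Y : D ⥤ C} (c : X ⟶ W) (p : W ⟶ Y)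
    [∀ x, HasLiftingProperty (relativeLatchingMap c x) (p.app x)]
    (hmin : ∀ x, IsMinimalFactorization (relativeLatchingMap c x) (p.app x)) :
    IsMinimalFactorization c p := by
  intro φ hc hp
  rw [NatTrans.isIso_iff_isIso_app]
  intro x
  induction x using WellFoundedLT.induction with
  | ind x ih =>
    have := isIso_relativeLatchingObjMap φ hc x ih
    exact (hmin x).isIso_of_comm (φ.app x) (relativeLatchingObjMap φ hc x)
      (relativeLatchingObjMap_comp_relativeLatchingMap _ _ _).symm (NatTrans.congr_app hp x)

end Minimal

section ModelStructure

instance {C : Type*} [Category* C] (W : MorphismProperty C) [W.HasTwoOutOfThreeProperty]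
    (J : Type*) [Category* J] : (W.functorCategory J).HasTwoOutOfThreeProperty where
  comp_mem _ _ hf hg x := W.comp_mem _ _ (hf x) (hg x)
  of_postcomp _ _ hg hfg x := W.of_postcomp _ _ (hg x) (hfg x)
  of_precomp _ _ hf hfg x := W.of_precomp _ _ (hf x) (hfg x)

variable (D : Type w) [PartialOrder D] (C : Type u) [Category.{v} C] [ModelCategory C]

lemma objectwiseWeakEquivalences_eq :
    objectwiseWeakEquivalences D C = (weakEquivalences C).functorCategory D := by
  ext
  exact forall_congr' fun x => weakEquivalence_iff _

lemma objectwiseFibrations_eq :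
    objectwiseFibrations D C = (fibrations C).functorCategory D := by
  ext
  exact forall_congr' fun x => fibration_iff _

lemma functorCategory_trivialFibrations :
    (trivialFibrations C).functorCategory D =
      (fibrations C).functorCategory D ⊓ (weakEquivalences C).functorCategory D := by
  ext
  exact forall_and

variable [Finite D]

lemma latchingCofibrations_eq :
    latchingCofibrations D C = latchingProperty D (cofibrations C) := by
  ext
  exact forall_congr' fun x => cofibration_iff _

theorem latchingProperty_trivialCofibrations_le :
    latchingProperty D (trivialCofibrations C) ≤ (weakEquivalences C).functorCategory D := by
  have hllp := (trivialCofibrations C).llp_eq_of_wfs (fibrations C)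
  intro A B i hi x
  rw [← hllp, latchingProperty_llp] at hi
  have hix := llp_functorCategory_le (fibrations C) D i hi x
  rw [hllp] at hix
  exact hix.2

theorem latchingProperty_trivialCofibrations :
    latchingProperty D (trivialCofibrations C) =
      latchingProperty D (cofibrations C) ⊓ (weakEquivalences C).functorCategory D := by
  have hcof := isWeakFactorizationSystem_latchingProperty D (cofibrations C) (trivialFibrations C)
  have htriv := isWeakFactorizationSystem_latchingProperty D (trivialCofibrations C) (fibrations C)
  have hretract : (latchingProperty D (trivialCofibrations C)).IsStableUnderRetracts :=
    htriv.llp ▸ inferInstance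
  refine le_antisymm (le_inf (fun _ _ _ hi x => (hi x).1)
    (latchingProperty_trivialCofibrations_le D C)) fun A B i ⟨hi, hiw⟩ => ?_
  obtain ⟨_, c, p, hfac, hc, hp⟩ := MorphismProperty.factorizationData
    (latchingProperty D (trivialCofibrations C)) ((fibrations C).functorCategory D) i
  have hpw : (weakEquivalences C).functorCategory D p :=
    MorphismProperty.of_precomp _ c p (latchingProperty_trivialCofibrations_le D C c hc)
      (hfac ▸ hiw)
  have : HasLiftingProperty i p := MorphismProperty.hasLiftingProperty_of_wfs _ _ hi
    ((functorCategory_trivialFibrations D C).ge p ⟨hp, hpw⟩)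
  exact MorphismProperty.of_retract (RetractArrow.ofLeftLiftingProperty hfac) hc

/-- The projective model structure on the functors from a finite poset to a model category. -/
@[reducible]
noncomputable def modelCategoryFunctor : ModelCategory (D ⥤ C) :=
  letI : CategoryWithFibrations (D ⥤ C) := ⟨objectwiseFibrations D C⟩
  letI : CategoryWithCofibrations (D ⥤ C) := ⟨latchingCofibrations D C⟩
  letI : CategoryWithWeakEquivalences (D ⥤ C) := ⟨objectwiseWeakEquivalences D C⟩
  have hfib : fibrations (D ⥤ C) = (fibrations C).functorCategory D :=
    objectwiseFibrations_eq D C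
  have hcof : cofibrations (D ⥤ C) = latchingProperty D (cofibrations C) :=
    latchingCofibrations_eq D C
  have hweq : weakEquivalences (D ⥤ C) = (weakEquivalences C).functorCategory D :=
    objectwiseWeakEquivalences_eq D C
  haveI : (weakEquivalences (D ⥤ C)).HasTwoOutOfThreeProperty := hweq ▸ inferInstance
  haveI : (cofibrations (D ⥤ C)).IsWeakFactorizationSystem (trivialFibrations (D ⥤ C)) := by
    rw [trivialFibrations, hfib, hcof, hweq, ← functorCategory_trivialFibrations]
    exact isWeakFactorizationSystem_latchingProperty D _ _
  haveI : (trivialCofibrations (D ⥤ C)).IsWeakFactorizationSystem (fibrations (D ⥤ C)) := by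
    rw [trivialCofibrations, hfib, hcof, hweq, ← latchingProperty_trivialCofibrations]
    exact isWeakFactorizationSystem_latchingProperty D _ _
  ModelCategory.mk' (D ⥤ C)

variable {D C}

theorem minimalCofibrantFactorizationAxiom_functor (h : MinimalCofibrantFactorizationAxiom C) :
    @MinimalCofibrantFactorizationAxiom (D ⥤ C) _ (modelCategoryFunctor D C) := by
  let := modelCategoryFunctor D C
  intro X Y f
  obtain ⟨W, c, p, hf, hcp⟩ := exists_latching_factorization
    (composablePairs (cofibrations C) (trivialFibrations C) ⊓ minimalFactorizations C)
    (fun A Z f => by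
      obtain ⟨B, c, p, hf, hc, hp, hw, hm⟩ := h f
      exact ⟨B, c, p, hf, ⟨mem_cofibrations c, mem_trivialFibrations p⟩, hm⟩) f
  have hc (x : D) : cofibrations C (relativeLatchingMap c x) := (hcp x).1.1
  have hp (x : D) : trivialFibrations C (p.app x) := (hcp x).1.2
  have (x : D) : HasLiftingProperty (relativeLatchingMap c x) (p.app x) :=
    MorphismProperty.hasLiftingProperty_of_wfs _ _ (hc x) (hp x)
  exact ⟨W, c, p, hf, ⟨fun x => ⟨hc x⟩⟩, ⟨fun x => ⟨(hp x).1⟩⟩, ⟨fun x => ⟨(hp x).2⟩⟩,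
    isMinimalFactorization_of_relativeLatchingMap c p fun x => (hcp x).2⟩

end ModelStructure

end FinitePosetModel

theorem mainTheorem11 (D : Type w) [PartialOrder D] [Finite D]
    (C : Type u) [Category.{v} C] [ModelCategory C] :
    ∃ M : ModelCategory (D ⥤ C),
      M.categoryWithWeakEquivalences.weakEquivalences =
        FinitePosetModel.objectwiseWeakEquivalences D C ∧
      M.categoryWithFibrations.fibrations = FinitePosetModel.objectwiseFibrations D C ∧
      M.categoryWithCofibrations.cofibrations = FinitePosetModel.latchingCofibrations D C ∧
      (FinitePosetModel.MinimalCofibrantFactorizationAxiom C →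
        @FinitePosetModel.MinimalCofibrantFactorizationAxiom (D ⥤ C) _ M) :=
  ⟨FinitePosetModel.modelCategoryFunctor D C, rfl, rfl, rfl,
    FinitePosetModel.minimalCofibrantFactorizationAxiom_functor⟩
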